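/- Let $X$ be a real Hilbert space and let $\varphi : X \to \mathbb{R}$ be a $C^1$ function whose derivative $\varphi'$ (identified with the gradient, a map $X \to X$) is Lipschitz with constant $L \ge 0$, that is, $\|\varphi'(x) - \varphi'(y)\| \le L\|x-y\|$ for all $x, y \in X$. Assume that $L > 0$ or $\varphi'(0) \ne 0$. Let $\eta : X \to \,]0,+\infty[$ be a continuous, Gateaux differentiable, convex function, with Gateaux derivative $\eta'$ (likewise identified with a map $X \to X$), such that $$|\varphi(0)| + \|\varphi'(0)\|\,\|x\| \le \eta(x) \qquad \text{for all } x \in X.$$ Then there exists $\tilde x \in X$ such that $$\varphi(\tilde x)\,\varphi'(\tilde x) + \left(\frac{L}{2}\|\tilde x\|^2 + \eta(\tilde x)\right)\bigl(L\tilde x + \eta'(\tilde x)\bigr) = 0.$$ -/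

import Mathlib

open scoped NNReal Gradient

/-- `f` is Gateaux differentiable at `x` with Gateaux derivative `g`: for every direction `v`,
the limit of `(f (x + t v) - f x) / t` as `t → 0` exists and equals `⟪g, v⟫`. The derivative, a
continuous linear functional on the Hilbert space `X`, is identified with the vector `g` which
represents it by the Riesz theorem; `g` is uniquely determined by `f` and `x`. -/
def HasGateauxGradientAt {X : Type*} [NormedAddCommGroup X] [InnerProductSpace ℝ X]
    (f : X → ℝ) (g x : X) : Prop :=
  ∀ v : X, HasLineDerivAt ℝ f (inner ℝ g v) x v

/-! Put ψ = (L/2)‖x‖² + η. The equation says that the Gateaux gradient of (φ² + ψ²)/2 vanishes, so a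
minimum of φ² + ψ² suffices. The Lipschitz bound makes ψ ± φ convex, and the descent lemma at 0 with
the bound on η gives |φ| ≤ ψ. Hence φ² + ψ² = ((ψ + φ)² + (ψ - φ)²)/2 is convex, being built from
squares of nonnegative convex functions. It is coercive since ψ is, so its sublevel sets are
bounded, closed and convex, and a minimum exists. -/

/-- A decreasing sequence of nonempty bounded closed convex subsets of a Hilbert space has a common
point. -/
theorem nonempty_iInter_of_antitone_convex {X : Type*} [NormedAddCommGroup X]
    [InnerProductSpace ℝ X] [CompleteSpace X] (C : ℕ → Set X) (hanti : Antitone C)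
    (hne : ∀ n, (C n).Nonempty) (hclosed : ∀ n, IsClosed (C n)) (hconv : ∀ n, Convex ℝ (C n))
    (hbdd : Bornology.IsBounded (C 0)) : (⋂ n, C n).Nonempty := by
  -- Points of minimal norm, with their variational inequality; their norms increase and stay
  -- bounded, which forces a Cauchy sequence.
  have hex : ∀ n, ∃ v ∈ C n, ∀ w ∈ C n, ‖v‖ ^ 2 ≤ inner ℝ v w := by
    intro n
    obtain ⟨v, hv, hv'⟩ := exists_norm_eq_iInf_of_complete_convex (hne n)
      (hclosed n).isComplete (hconv n) 0
    refine ⟨v, hv, fun w hw => ?_⟩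
    have h := (norm_eq_iInf_iff_real_inner_le_zero (hconv n) hv).1 hv' w hw
    rw [zero_sub, inner_neg_left, inner_sub_right, real_inner_self_eq_norm_sq] at h
    linarith
  choose x hxC hx using hex
  have hdist : ∀ m n, m ≤ n → ‖x n - x m‖ ^ 2 ≤ ‖x n‖ ^ 2 - ‖x m‖ ^ 2 := by
    intro m n hmn
    have h := hx m (x n) (hanti hmn (hxC n))
    rw [norm_sub_sq_real, real_inner_comm]
    linarith
  have hmono : Monotone fun n => ‖x n‖ ^ 2 := fun m n hmn => by
    have := hdist m n hmn
    have := sq_nonneg ‖x n - x m‖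
    dsimp only
    linarith
  obtain ⟨R, hR⟩ := hbdd.exists_norm_le
  have hbound : BddAbove (Set.range fun n => ‖x n‖ ^ 2) := by
    refine ⟨R ^ 2, ?_⟩
    rintro _ ⟨n, rfl⟩
    exact pow_le_pow_left₀ (norm_nonneg _) (hR _ (hanti (Nat.zero_le n) (hxC n))) 2
  have hcauchy := (tendsto_atTop_ciSup hmono hbound).cauchySeq
  have hx_cauchy : CauchySeq x := by
    rw [Metric.cauchySeq_iff'] at hcauchy ⊢
    intro ε hε
    obtain ⟨N, hN⟩ := hcauchy (ε ^ 2) (by positivity)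
    refine ⟨N, fun n hn => ?_⟩
    have h := hN n hn
    rw [Real.dist_eq] at h
    rw [dist_eq_norm]
    exact lt_of_pow_lt_pow_left₀ 2 hε.le
      (((hdist N n hn).trans (le_abs_self _)).trans_lt h)
  obtain ⟨a, ha⟩ := cauchySeq_tendsto_of_complete hx_cauchy
  refine ⟨a, Set.mem_iInter.2 fun n => (hclosed n).mem_of_tendsto ha ?_⟩
  filter_upwards [Filter.eventually_ge_atTop n] with m hm
  exact hanti hm (hxC m)

/-- A continuous convex function on a Hilbert space which is bounded below and has bounded
sublevel sets attains its minimum. -/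
theorem ConvexOn.exists_forall_le_of_isBounded {X : Type*} [NormedAddCommGroup X]
    [InnerProductSpace ℝ X] [CompleteSpace X] {f : X → ℝ} (hconv : ConvexOn ℝ Set.univ f)
    (hcont : Continuous f) (hbelow : BddBelow (Set.range f))
    (hbdd : ∀ c, Bornology.IsBounded {x | f x ≤ c}) : ∃ x, ∀ y, f x ≤ f y := by
  set m := sInf (Set.range f)
  obtain ⟨x, hx⟩ := nonempty_iInter_of_antitone_convex
    (fun n : ℕ => {x | f x ≤ m + 1 / ((n : ℝ) + 1)})
    (fun i j hij x (hx : f x ≤ _) => hx.trans (by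
      have := Nat.one_div_le_one_div (α := ℝ) hij
      linarith))
    (fun n => by
      obtain ⟨_, ⟨x, rfl⟩, hx⟩ := exists_lt_of_csInf_lt (Set.range_nonempty f)
        (lt_add_of_pos_right m (Nat.one_div_pos_of_nat (α := ℝ) (n := n)))
      exact ⟨x, hx.le⟩)
    (fun n => isClosed_le hcont continuous_const)
    (fun n => by simpa using hconv.convex_le (m + 1 / ((n : ℝ) + 1)))
    (hbdd _)
  rw [Set.mem_iInter] at hx
  refine ⟨x, fun y => le_trans ?_ (csInf_le hbelow ⟨y, rfl⟩)⟩
  have hlim : Filter.Tendsto (fun n : ℕ => m + 1 / ((n : ℝ) + 1)) Filter.atTop (nhds (m + 0)) :=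
    tendsto_one_div_add_atTop_nhds_zero_nat.const_add m
  rw [add_zero] at hlim
  exact ge_of_tendsto' hlim hx

/-- The descent lemma: a function with `L`-Lipschitz gradient is above its quadratic minorants. -/
theorem LipschitzWith.quadratic_minorant_of_hasGradientAt {X : Type*} [NormedAddCommGroup X]
    [InnerProductSpace ℝ X] [CompleteSpace X] {f : X → ℝ} {g : X → X} {L : ℝ≥0}
    (hg : LipschitzWith L g) (hf : ∀ x, HasGradientAt f (g x) x) (x y : X) :
    f x + inner ℝ (g x) (y - x) - (L : ℝ) / 2 * ‖y - x‖ ^ 2 ≤ f y := by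
  set v := y - x with hv
  -- On [0, 1] this function is nondecreasing, by Cauchy–Schwarz and the Lipschitz bound; its values
  -- at 0 and 1 give the claim.
  have hderiv : ∀ t : ℝ, HasDerivAt
      (fun t : ℝ => f (x + t • v) - t * inner ℝ (g x) v + (L : ℝ) / 2 * ‖v‖ ^ 2 * t ^ 2)
      (inner ℝ (g (x + t • v)) v - inner ℝ (g x) v + (L : ℝ) * ‖v‖ ^ 2 * t) t := by
    intro t
    have hline : HasDerivAt (fun t : ℝ => x + t • v) v t := by
      simpa using ((hasDerivAt_id t).smul_const v).const_add x
    have h1 : HasDerivAt (fun t : ℝ => f (x + t • v)) (inner ℝ (g (x + t • v)) v) t := by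
      have h := (hf (x + t • v)).hasFDerivAt.comp_hasDerivAt t hline
      rw [InnerProductSpace.toDual_apply_apply] at h
      exact h
    have h2 := ((hasDerivAt_id t).mul_const (inner ℝ (g x) v : ℝ))
    have h3 := ((hasDerivAt_id t).pow 2).const_mul ((L : ℝ) / 2 * ‖v‖ ^ 2)
    refine ((h1.sub h2).add h3).congr_deriv ?_
    simp only [id, one_mul, Nat.cast_ofNat, Nat.add_one_sub_one, pow_one, mul_one]
    ring
  have hmono := monotoneOn_of_deriv_nonneg (convex_Icc (0 : ℝ) 1)
    (fun t _ => (hderiv t).continuousAt.continuousWithinAt)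
    (fun t _ => (hderiv t).differentiableAt.differentiableWithinAt) (fun t ht => by
      rw [interior_Icc] at ht
      rw [(hderiv t).deriv, ← inner_sub_left]
      have h1 := neg_le_of_abs_le (abs_real_inner_le_norm (g (x + t • v) - g x) v)
      have h2 : ‖g (x + t • v) - g x‖ ≤ L * (t * ‖v‖) := by
        simpa [dist_eq_norm, norm_smul, abs_of_pos ht.1] using hg.dist_le_mul (x + t • v) x
      have h3 := mul_le_mul_of_nonneg_right h2 (norm_nonneg v)
      linarith)
  have h := hmono (Set.left_mem_Icc.2 zero_le_one) (Set.right_mem_Icc.2 zero_le_one) zero_le_one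
  have hxy : x + v = y := by rw [hv]; abel
  simp only [zero_smul, add_zero, zero_mul, sub_zero, one_smul, one_mul, hxy, one_pow, mul_one,
    ne_eq, OfNat.ofNat_ne_zero, not_false_eq_true, zero_pow, mul_zero] at h
  linarith

/-- A function on an inner product space with a subgradient at every point is convex. -/
theorem convexOn_univ_of_forall_subgradient {X : Type*} [NormedAddCommGroup X]
    [InnerProductSpace ℝ X] {f : X → ℝ} {g : X → X}
    (h : ∀ x y, f x + inner ℝ (g x) (y - x) ≤ f y) : ConvexOn ℝ Set.univ f := by
  refine ⟨convex_univ, fun x _ y _ a b ha hb hab => ?_⟩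
  set z := a • x + b • y with hz
  have h0 : a * inner ℝ (g z) (x - z) + b * inner ℝ (g z) (y - z) = 0 := by
    rw [← inner_smul_right, ← inner_smul_right, ← inner_add_right]
    have : a • (x - z) + b • (y - z) = a • x + b • y - (a + b) • z := by module
    rw [this, hab, one_smul, ← hz, sub_self, inner_zero_right]
  have hx := mul_le_mul_of_nonneg_left (h z x) ha
  have hy := mul_le_mul_of_nonneg_left (h z y) hb
  have hsum : a * f z + b * f z = f z := by rw [← add_mul, hab, one_mul]
  simp only [smul_eq_mul]
  linarith

/-- A function with `L`-Lipschitz gradient becomes convex after adding `L / 2 * ‖x‖ ^ 2`. -/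
theorem LipschitzWith.convexOn_add_sq_of_hasGradientAt {X : Type*} [NormedAddCommGroup X]
    [InnerProductSpace ℝ X] [CompleteSpace X] {f : X → ℝ} {g : X → X} {L : ℝ≥0}
    (hg : LipschitzWith L g) (hf : ∀ x, HasGradientAt f (g x) x) :
    ConvexOn ℝ Set.univ fun x => f x + (L : ℝ) / 2 * ‖x‖ ^ 2 := by
  refine convexOn_univ_of_forall_subgradient (g := fun x => g x + (L : ℝ) • x) fun x y => ?_
  have h := hg.quadratic_minorant_of_hasGradientAt hf x y
  rw [norm_sub_sq_real, real_inner_comm x y] at h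
  rw [inner_add_left, real_inner_smul_left, inner_sub_right x, real_inner_self_eq_norm_sq]
  linarith

/-- Outside the unit ball ‖x‖ ≤ ‖x‖², so f x ≥ (a + b)‖x‖ there. -/
theorem isBounded_sublevel_of_quadratic_growth {X : Type*} [SeminormedAddCommGroup X] {f : X → ℝ}
    {a b : ℝ} (ha : 0 ≤ a) (hb : 0 ≤ b) (hab : 0 < a ∨ 0 < b)
    (hf : ∀ x, a * ‖x‖ ^ 2 + b * ‖x‖ ≤ f x) (c : ℝ) : Bornology.IsBounded {x | f x ≤ c} := by
  refine isBounded_iff_forall_norm_le.2 ⟨max 1 (c / (a + b)), fun x (hx : f x ≤ c) => ?_⟩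
  rcases le_total ‖x‖ 1 with h | h
  · exact le_max_of_le_left h
  · refine le_max_of_le_right ((le_div_iff₀ (by rcases hab with h | h <;> linarith)).2 ?_)
    have h1 : a * ‖x‖ ≤ a * ‖x‖ ^ 2 :=
      mul_le_mul_of_nonneg_left (le_self_pow₀ h two_ne_zero) ha
    have := hf x
    linarith

theorem hasGateauxGradientAt_const_mul_norm_sq {X : Type*} [NormedAddCommGroup X]
    [InnerProductSpace ℝ X] (c : ℝ) (x : X) :
    HasGateauxGradientAt (fun x => c / 2 * ‖x‖ ^ 2) (c • x) x := by
  intro v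
  have hline : HasDerivAt (fun t : ℝ => x + t • v) v 0 := by
    simpa using ((hasDerivAt_id (0 : ℝ)).smul_const v).const_add x
  have h := hline.norm_sq.const_mul (c / 2)
  rw [zero_smul, add_zero, ← mul_assoc, div_mul_cancel₀ c two_ne_zero, ← real_inner_smul_left] at h
  exact h

/-- At a minimum of `f ^ 2 + g ^ 2` the combination `f • f' + g • g'` of Gateaux gradients
vanishes. -/
theorem smul_add_smul_eq_zero_of_forall_sq_add_sq_le {X : Type*} [NormedAddCommGroup X]
    [InnerProductSpace ℝ X] {f g : X → ℝ} {f' g' x : X} (hf : HasGateauxGradientAt f f' x)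
    (hg : HasGateauxGradientAt g g' x) (hmin : ∀ y, f x ^ 2 + g x ^ 2 ≤ f y ^ 2 + g y ^ 2) :
    f x • f' + g x • g' = 0 := by
  -- Tested in the direction `v` itself, the derivative is 2‖v‖².
  set v := f x • f' + g x • g' with hv
  have h1 : HasDerivAt (fun t : ℝ => f (x + t • v)) (inner ℝ f' v) 0 := hf v
  have h2 : HasDerivAt (fun t : ℝ => g (x + t • v)) (inner ℝ g' v) 0 := hg v
  have hlocal : IsLocalMin
      ((fun t : ℝ => f (x + t • v)) ^ 2 + (fun t : ℝ => g (x + t • v)) ^ 2) 0 :=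
    Filter.Eventually.of_forall fun t => by simpa using hmin (x + t • v)
  have h := hlocal.hasDerivAt_eq_zero ((h1.pow 2).add (h2.pow 2))
  simp only [zero_smul, add_zero, Nat.cast_ofNat, Nat.add_one_sub_one, pow_one] at h
  rw [← inner_self_eq_zero (𝕜 := ℝ)]
  nth_rewrite 1 [hv]
  rw [inner_add_left, real_inner_smul_left, real_inner_smul_left]
  linarith

theorem corollary3p3 {X : Type*} [NormedAddCommGroup X] [InnerProductSpace ℝ X] [CompleteSpace X]
    (φ : X → ℝ) (hφ : ContDiff ℝ 1 φ)
    (L : ℝ≥0) (hLip : LipschitzWith L (∇ φ)) (hL : 0 < L ∨ ∇ φ 0 ≠ 0)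
    (η : X → ℝ) (η' : X → X) (hη_pos : ∀ x, 0 < η x) (hη_cont : Continuous η)
    (hη_diff : ∀ x, HasGateauxGradientAt η (η' x) x) (hη_conv : ConvexOn ℝ Set.univ η)
    (hbound : ∀ x, |φ 0| + ‖∇ φ 0‖ * ‖x‖ ≤ η x) :
    ∃ x : X, φ x • ∇ φ x + ((L : ℝ) / 2 * ‖x‖ ^ 2 + η x) • ((L : ℝ) • x + η' x) = 0 := by
  have hgrad : ∀ x, HasGradientAt φ (∇ φ x) x := fun x =>
    (hφ.differentiable one_ne_zero x).hasGradientAt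
  have hgrad_neg : ∀ x, HasGradientAt (fun x => -φ x) (-∇ φ x) x := fun x => by
    have h := (hgrad x).hasFDerivAt.neg
    rw [← map_neg] at h
    exact h
  have hLip_neg : LipschitzWith L fun x => -∇ φ x := hLip.neg
  set ψ : X → ℝ := fun x => (L : ℝ) / 2 * ‖x‖ ^ 2 + η x with hψ
  have hconv_add : ConvexOn ℝ Set.univ fun x => ψ x + φ x :=
    ((hLip.convexOn_add_sq_of_hasGradientAt hgrad).add hη_conv).congr fun x _ => by
      simp only [hψ, Pi.add_apply]; ring
  have hconv_sub : ConvexOn ℝ Set.univ fun x => ψ x - φ x :=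
    ((hLip_neg.convexOn_add_sq_of_hasGradientAt hgrad_neg).add hη_conv).congr fun x _ => by
      simp only [hψ, Pi.add_apply]; ring
  have habs : ∀ x, |φ x| ≤ ψ x := fun x => by
    have h1 := hLip.quadratic_minorant_of_hasGradientAt hgrad 0 x
    have h2 := hLip_neg.quadratic_minorant_of_hasGradientAt hgrad_neg 0 x
    rw [sub_zero] at h1 h2
    rw [inner_neg_left] at h2
    have h3 := abs_le.1 (abs_real_inner_le_norm (∇ φ 0) x)
    have h4 := hbound x
    have h5 := abs_le.1 (le_refl |φ 0|)
    simp only [hψ]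
    exact abs_le.2 ⟨by linarith, by linarith⟩
  have hψ_cont : Continuous ψ := by fun_prop
  have hψ_bdd : ∀ c, Bornology.IsBounded {x | ψ x ≤ c} :=
    isBounded_sublevel_of_quadratic_growth (a := (L : ℝ) / 2) (b := ‖∇ φ 0‖) (by positivity)
      (norm_nonneg _) (hL.imp (fun h => half_pos (NNReal.coe_pos.2 h)) norm_pos_iff.2)
      fun x => by
        have := hbound x
        have := abs_nonneg (φ 0)
        simp only [hψ]
        linarith
  have hconv : ConvexOn ℝ Set.univ fun x => φ x ^ 2 + ψ x ^ 2 :=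
    (((hconv_add.pow (fun x _ => by linarith [neg_le_of_abs_le (habs x)]) 2).add
      (hconv_sub.pow (fun x _ => by linarith [le_of_abs_le (habs x)]) 2)).smul
        (c := (1 / 2 : ℝ)) (by norm_num)).congr fun x _ => by
      simp only [Pi.add_apply, Pi.pow_apply, smul_eq_mul]; ring
  obtain ⟨x, hx⟩ := hconv.exists_forall_le_of_isBounded
    ((hφ.continuous.pow 2).add (hψ_cont.pow 2))
    ⟨0, by rintro _ ⟨x, rfl⟩; positivity⟩
    -- Where ψ ≥ 1, ψ ≤ ψ² ≤ c; elsewhere ψ ≤ 1.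
    fun c => (hψ_bdd (max c 1)).subset fun x (hx : φ x ^ 2 + ψ x ^ 2 ≤ c) => by
      rcases le_total (ψ x) 1 with h | h
      · exact le_max_of_le_right h
      · exact le_max_of_le_left (by
          have hle : ψ x ≤ c := by linarith [sq_nonneg (φ x), le_self_pow₀ h two_ne_zero]
          exact hle)
  refine ⟨x, smul_add_smul_eq_zero_of_forall_sq_add_sq_le (g := ψ) (fun v => ?_) (fun v => ?_) hx⟩
  · simpa using (hgrad x).hasFDerivAt.hasLineDerivAt v
  · have h := HasDerivAt.add (hasGateauxGradientAt_const_mul_norm_sq (L : ℝ) x v) (hη_diff x v)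
    rw [← inner_add_left] at h
    exact h
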